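/- There exist absolute constants $c, C > 0$ such that the following holds. Let $N \ge 1$, $n = N^2$, $\sigma \ge 0$, $\delta \in (0,1)$ and $\theta^* \in \mathbb{R}^{N\times N} \cong \mathbb{R}^n$, and observe $y = \theta^* + \varepsilon$ with $\varepsilon \sim \mathcal{N}(0, \sigma^2 I_n)$. Let $D_1 \in \mathbb{R}^{(N-1)\times N}$, $(D_1 x)_j = x_{j+1} - x_j$, be the incidence matrix of the path, let $$D = \begin{bmatrix} D_1 \otimes I \\ I \otimes D_1 \end{bmatrix}$$ be the incidence matrix of the $N \times N$ grid, and let the TV denoiser $\hat\theta$ be any solution of $$\hat\theta \in \operatorname*{argmin}_{\theta \in \mathbb{R}^n} \frac1n \|\theta - y\|_2^2 + \lambda \|D\theta\|_1, \qquad \lambda = \frac{c\,\sigma \sqrt{(\log n)\log(en/\delta)}}{n}.$$ Let $\theta^\uparrow$ be the Euclidean projection of $\theta^*$ onto the set of bi-isotonic matrices $$\mathcal{M} = \{\theta \in \mathbb{R}^{N\times N} : \theta_{j_1,j_2} \ge \theta_{i_1,i_2} \text{ whenever } j_1 \ge i_1 \text{ and } j_2 \ge i_2\},$$ and let $V(\theta^\uparrow)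 = (\theta^\uparrow_{N,N} - \theta^\uparrow_{1,1})^2$ be its square variation. Then, with probability at least $1 - 2\delta$, $$\frac1n \|\hat\theta - \theta^*\|_2^2 \le \frac1n \|\theta^\uparrow - \theta^*\|_2^2 + C\sigma \sqrt{\frac{(\log n)\log(n/\delta)}{n}}\,\sqrt{V(\theta^\uparrow)} + \frac{C\sigma^2}{n} \log(e/\delta).$$ -/

import Mathlib

open MeasureTheory ProbabilityTheory
open scoped Kronecker

namespace TVDenoising

/-- The space of `N × N` images (matrices), vectorized: `ℝ^n` with `n = N ^ 2`, carrying the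
Euclidean norm. -/
abbrev Image (N : ℕ) : Type := EuclideanSpace ℝ (Fin N × Fin N)

/-- Incidence matrix of the path graph on `N` vertices: `(D₁ x)_j = x_{j+1} - x_j`. -/
def pathIncidence (N : ℕ) : Matrix (Fin (N - 1)) (Fin N) ℝ :=
  Matrix.of fun j i =>
    if (i : ℕ) = (j : ℕ) + 1 then 1 else if (i : ℕ) = (j : ℕ) then -1 else 0

/-- Incidence matrix of the two-dimensional `N × N` grid graph: the rows of `D₁ ⊗ I` stacked
on top of the rows of `I ⊗ D₁`. -/
def gridIncidence (N : ℕ) :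
    Matrix ((Fin (N - 1) × Fin N) ⊕ (Fin N × Fin (N - 1))) (Fin N × Fin N) ℝ :=
  Matrix.fromRows
    (pathIncidence N ⊗ₖ (1 : Matrix (Fin N) (Fin N) ℝ))
    ((1 : Matrix (Fin N) (Fin N) ℝ) ⊗ₖ pathIncidence N)

/-- The total variation `‖D θ‖₁` of an image along the edges of the grid. -/
noncomputable def totalVariation {N : ℕ} (θ : Image N) : ℝ :=
  ∑ e, |(gridIncidence N).mulVec θ.ofLp e|

/-- The objective `(1 / n) ‖θ - y‖² + lam ‖D θ‖₁`, where `n = N ^ 2`. -/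
noncomputable def tvObjective {N : ℕ} (y : Image N) (lam : ℝ) (θ : Image N) : ℝ :=
  1 / (N : ℝ) ^ 2 * ‖θ - y‖ ^ 2 + lam * totalVariation θ

/-- `θhat` is a TV denoiser for the observation `y` and regularization parameter `lam`:
a global minimizer of the objective. -/
def IsTVDenoiser {N : ℕ} (y : Image N) (lam : ℝ) (θhat : Image N) : Prop :=
  IsMinOn (tvObjective y lam) Set.univ θhat

/-- Mean squared error `(1 / n) ‖θ - θstar‖²`, where `n = N ^ 2`. -/
noncomputable def mse {N : ℕ} (θ θstar : Image N) : ℝ :=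
  1 / (N : ℝ) ^ 2 * ‖θ - θstar‖ ^ 2

/-- The class of bi-isotonic matrices. -/
def biIsotonic (N : ℕ) : Set (Image N) :=
  {θ | ∀ i₁ i₂ j₁ j₂ : Fin N, i₁ ≤ j₁ → i₂ ≤ j₂ → θ (i₁, i₂) ≤ θ (j₁, j₂)}

/-- `p` is a Euclidean (metric) projection of `x` onto the set `M`. -/
def IsProjectionOnto {N : ℕ} (M : Set (Image N)) (x p : Image N) : Prop :=
  p ∈ M ∧ IsMinOn (fun θ => ‖θ - x‖) M p

/-- The square variation `(θ_{N,N} - θ_{1,1})²`. -/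
def squareVariation {N : ℕ} (hN : 0 < N) (θ : Image N) : ℝ :=
  (θ (⟨N - 1, Nat.sub_lt hN Nat.one_pos⟩, ⟨N - 1, Nat.sub_lt hN Nat.one_pos⟩)
    - θ (⟨0, hN⟩, ⟨0, hN⟩)) ^ 2

/-- The regularization parameter `c σ √(log n · log (e n / δ)) / n`. -/
noncomputable def tvParameter (c σ δ n : ℝ) : ℝ :=
  c * σ * √(Real.log n * Real.log (Real.exp 1 * n / δ)) / n

end TVDenoising

namespace TVDenoising

open Real Finset

/-! Comparing the denoiser with an arbitrary image θ gives, by convexity, ‖θhat - θ*‖² + ‖θhat - θ‖²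
≤ ‖θ - θ*‖² + 2⟨ε, θhat - θ⟩ + nλ(TV θ - TV θhat), which is `IsTVDenoiser.sq_dist_add_le`. The noise
term splits (`inner_eq_add_sum_pinvColumn`) into a constant mode, absorbed by the extra ‖θhat - θ‖²,
and a pairing of D(θhat - θ) with the pseudoinverse columns tested against ε. If these coefficients
are at most nλ/2, the penalty cancels TV θhat and 2nλ TV θ remains. For bi-isotonic θ, TV is at most
2N√V.

So λ is governed by the largest column norm of the pseudoinverse, which is O(√log N) by
`norm_pinvColumn_sq_le`. Discrete cosines diagonalize the grid Laplacian and are delocalized, so the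
squared norm is bounded by the lattice sum of 1/(k² + l²), and in two dimensions this diverges only
logarithmically. Gaussian tails and a union bound over edges give an event that does not depend on
the choice of minimizer. -/

/-! ### Orthonormality of the discrete cosine vectors -/

lemma sum_two_sin_mul_cos_odd (a : ℝ) (n : ℕ) :
    ∑ i ∈ range n, 2 * sin a * cos ((2 * i + 1) * a) = sin (2 * n * a) := by
  induction n with
  | zero => simp
  | succ n ih =>
    rw [sum_range_succ, ih]
    have h1 : 2 * ((n + 1 : ℕ) : ℝ) * a = (2 * n + 1) * a + a := by push_cast; ring
    have h2 : 2 * (n : ℝ) * a = (2 * n + 1) * a - a := by ring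
    rw [h1, h2, sin_add, sin_sub]
    ring

/-- The base angle `π k / (2 N)` of the discrete cosine transform. -/
noncomputable def dctAngle (N k : ℕ) : ℝ := π * k / (2 * N)

lemma sum_cos_dctAngle_eq_zero {N m : ℕ} (hm : 0 < m) (hmN : m < 2 * N) :
    ∑ i ∈ range N, cos ((2 * i + 1) * dctAngle N m) = 0 := by
  have hN : (0 : ℝ) < N := by exact_mod_cast (by omega : 0 < N)
  have hm' : (0 : ℝ) < m := by exact_mod_cast hm
  have hmN' : (m : ℝ) < 2 * N := by exact_mod_cast hmN
  have hs : 0 < sin (dctAngle N m) := by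
    apply sin_pos_of_pos_of_lt_pi
    · unfold dctAngle; positivity
    · unfold dctAngle
      rw [div_lt_iff₀ (by positivity)]
      exact mul_lt_mul_of_pos_left hmN' pi_pos
  have h := sum_two_sin_mul_cos_odd (dctAngle N m) N
  have h2 : 2 * (N : ℝ) * dctAngle N m = m * π := by unfold dctAngle; field_simp
  rw [h2, sin_nat_mul_pi, ← mul_sum] at h
  exact (mul_eq_zero.mp h).resolve_left (by positivity)

/-- The normalizing constant of the `k`-th vector of the discrete cosine transform. -/
noncomputable def dctScale (N k : ℕ) : ℝ := if k = 0 then √(1 / N) else √(2 / N)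

/-- The `k`-th vector of the orthonormal discrete cosine transform of length `N`. -/
noncomputable def dctVec (N k i : ℕ) : ℝ := dctScale N k * cos ((2 * i + 1) * dctAngle N k)

lemma dctScale_sq_le (N k : ℕ) : dctScale N k ^ 2 ≤ 2 / N := by
  unfold dctScale
  split_ifs
  · rw [sq_sqrt (by positivity)]; gcongr; norm_num
  · rw [sq_sqrt (by positivity)]

lemma dctVec_sq_le (N k i : ℕ) : dctVec N k i ^ 2 ≤ 2 / N := by
  unfold dctVec
  rw [mul_pow]
  refine (mul_le_of_le_one_right (sq_nonneg _) (cos_sq_le_one _)).trans (dctScale_sq_le N k)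

lemma dctAngle_add (N k l : ℕ) : dctAngle N (k + l) = dctAngle N k + dctAngle N l := by
  unfold dctAngle; push_cast; ring

/-- Product-to-sum: the frequencies l + k and l - k both lie strictly between 0 and 2N, so each
cosine sum vanishes. -/
lemma sum_dctVec_mul_of_lt {N k l : ℕ} (hkl : k < l) (hl : l < N) :
    ∑ i ∈ range N, dctVec N k i * dctVec N l i = 0 := by
  obtain ⟨m, rfl⟩ := Nat.exists_eq_add_of_lt hkl
  have h1 := sum_cos_dctAngle_eq_zero (N := N) (m := k + (k + m + 1)) (by omega) (by omega)
  have h2 := sum_cos_dctAngle_eq_zero (N := N) (m := m + 1) (by omega) (by omega)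
  have h3 : ∀ i ∈ range N, dctVec N k i * dctVec N (k + m + 1) i =
      dctScale N k * dctScale N (k + m + 1) / 2 *
      (cos ((2 * i + 1) * dctAngle N (k + (k + m + 1)))
        + cos ((2 * i + 1) * dctAngle N (m + 1))) := by
    intro i _
    have e1 : (2 * (i : ℝ) + 1) * dctAngle N (k + (k + m + 1)) =
      (2 * i + 1) * dctAngle N (k + m + 1) + (2 * i + 1) * dctAngle N k := by
      rw [dctAngle_add]; ring
    have e2 : (2 * (i : ℝ) + 1) * dctAngle N (m + 1) =
      (2 * i + 1) * dctAngle N (k + m + 1) - (2 * i + 1) * dctAngle N k := by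
      have : dctAngle N (k + m + 1) = dctAngle N k + dctAngle N (m + 1) := by
        rw [add_assoc, dctAngle_add]
      rw [this]; ring
    rw [e1, e2, cos_add, cos_sub]
    unfold dctVec
    ring
  rw [sum_congr rfl h3, ← mul_sum, sum_add_distrib, h1, h2]
  simp

lemma sum_dctVec_mul_self {N k : ℕ} (hk : k < N) :
    ∑ i ∈ range N, dctVec N k i * dctVec N k i = 1 := by
  have hN : (0 : ℝ) < N := by exact_mod_cast (by omega : 0 < N)
  rcases Nat.eq_zero_or_pos k with rfl | hk0
  · simp [dctVec, dctScale, dctAngle]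
    rw [← mul_inv, mul_self_sqrt hN.le]
    field_simp
  · have h1 := sum_cos_dctAngle_eq_zero (N := N) (m := k + k) (by omega) (by omega)
    have h3 : ∀ i ∈ range N, dctVec N k i * dctVec N k i =
        1 / N * (1 + cos ((2 * i + 1) * dctAngle N (k + k))) := by
      intro i _
      have e1 : (2 * (i : ℝ) + 1) * dctAngle N (k + k) = 2 * ((2 * i + 1) * dctAngle N k) := by
        rw [dctAngle_add]; ring
      rw [e1, cos_two_mul]
      unfold dctVec dctScale
      rw [if_neg hk0.ne']
      have := mul_self_sqrt (show (0 : ℝ) ≤ 2 / N by positivity)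
      rw [mul_mul_mul_comm, this]
      ring
    rw [sum_congr rfl h3, ← mul_sum, sum_add_distrib, h1]
    simp [hN.ne']

lemma sum_dctVec_mul {N k l : ℕ} (hk : k < N) (hl : l < N) :
    ∑ i ∈ range N, dctVec N k i * dctVec N l i = if k = l then 1 else 0 := by
  rcases lt_trichotomy k l with h | h | h
  · rw [if_neg h.ne, sum_dctVec_mul_of_lt h hl]
  · subst h; rw [if_pos rfl, sum_dctVec_mul_self hk]
  · rw [if_neg h.ne', ← sum_dctVec_mul_of_lt h hk]
    exact sum_congr rfl fun _ _ => mul_comm _ _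

/-! ### Spectrum of the path Laplacian -/

/-- The `k`-th eigenvalue of the Laplacian of the path on `N` vertices. -/
noncomputable def pathEigenvalue (N k : ℕ) : ℝ := 4 * sin (dctAngle N k) ^ 2

lemma pathEigenvalue_nonneg (N k : ℕ) : 0 ≤ pathEigenvalue N k := by
  unfold pathEigenvalue; positivity

lemma le_pathEigenvalue {N k : ℕ} (hk : k < N) :
    4 * (k : ℝ) ^ 2 / N ^ 2 ≤ pathEigenvalue N k := by
  have hN : (0 : ℝ) < N := by exact_mod_cast (by omega : 0 < N)
  have hkN : (k : ℝ) ≤ N := by exact_mod_cast hk.le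
  have h := mul_le_sin (x := dctAngle N k) (by unfold dctAngle; positivity) (by
    unfold dctAngle
    rw [div_le_div_iff₀ (by positivity) (by positivity)]
    nlinarith [pi_pos, mul_le_mul_of_nonneg_left hkN pi_pos.le])
  have e : 2 / π * dctAngle N k = k / N := by unfold dctAngle; field_simp
  rw [e] at h
  have := pow_le_pow_left₀ (by positivity) h 2
  unfold pathEigenvalue
  rw [div_pow] at this
  calc 4 * (k : ℝ) ^ 2 / N ^ 2 = 4 * ((k : ℝ) ^ 2 / N ^ 2) := by ring
    _ ≤ _ := by gcongr

lemma dctVec_succ_sub (N k j : ℕ) :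
    dctVec N k (j + 1) - dctVec N k j =
      -(2 * sin (dctAngle N k) * dctScale N k) * sin (2 * (j + 1 : ℕ) * dctAngle N k) := by
  unfold dctVec
  have e1 : (2 * ((j + 1 : ℕ) : ℝ) + 1) * dctAngle N k =
    2 * ((j + 1 : ℕ) : ℝ) * dctAngle N k + dctAngle N k := by ring
  have e2 : (2 * (j : ℝ) + 1) * dctAngle N k =
    2 * ((j + 1 : ℕ) : ℝ) * dctAngle N k - dctAngle N k := by push_cast; ring
  rw [e1, e2, cos_add, cos_sub]
  ring

/-- Delocalization: no single edge carries more than an O(1/N) share of the eigenvalue. This is what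
makes the column bound uniform over edges. -/
lemma dctVec_succ_sub_sq_le (N k j : ℕ) :
    (dctVec N k (j + 1) - dctVec N k j) ^ 2 ≤ pathEigenvalue N k * (2 / N) := by
  rw [dctVec_succ_sub, mul_pow]
  refine (mul_le_of_le_one_right (sq_nonneg _) (sin_sq_le_one _)).trans ?_
  have := mul_le_mul_of_nonneg_left (dctScale_sq_le N k) (pathEigenvalue_nonneg N k)
  unfold pathEigenvalue at *
  linarith

lemma sum_range_sub_mul_succ (x s : ℕ → ℝ) (M : ℕ) :
    ∑ j ∈ range M, (x (j + 1) - x j) * s (j + 1) =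
      x M * s (M + 1) - x 0 * s 0 + ∑ j ∈ range (M + 1), x j * (s j - s (j + 1)) := by
  induction M with
  | zero => simp; ring
  | succ M ih => rw [sum_range_succ, ih, sum_range_succ _ (M + 1)]; ring

/-- The increments of a cosine vector are sines that vanish at both ends of the path, so summation
by parts leaves no boundary term. -/
lemma sum_sub_mul_dctVec_sub {N : ℕ} (hN : 0 < N) (k : ℕ) (x : ℕ → ℝ) :
    ∑ j ∈ range (N - 1), (x (j + 1) - x j) * (dctVec N k (j + 1) - dctVec N k j) =
      pathEigenvalue N k * ∑ i ∈ range N, x i * dctVec N k i := by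
  obtain ⟨M, rfl⟩ : ∃ M, N = M + 1 := ⟨N - 1, by omega⟩
  have h := sum_range_sub_mul_succ x (fun j => sin (2 * (j : ℝ) * dctAngle (M + 1) k)) M
  have h0 : sin (2 * ((M + 1 : ℕ) : ℝ) * dctAngle (M + 1) k) = 0 := by
    have : 2 * ((M + 1 : ℕ) : ℝ) * dctAngle (M + 1) k = k * π := by
      unfold dctAngle
      have : ((M + 1 : ℕ) : ℝ) ≠ 0 := by positivity
      field_simp
    rw [this, sin_nat_mul_pi]
  simp only [h0, Nat.cast_zero, mul_zero, zero_mul, sin_zero, sub_zero, zero_add] at h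
  have e1 : ∀ j ∈ range (M + 1 - 1), (x (j + 1) - x j) *
      (dctVec (M + 1) k (j + 1) - dctVec (M + 1) k j) =
      -(2 * sin (dctAngle (M + 1) k) * dctScale (M + 1) k) *
      ((x (j + 1) - x j) * sin (2 * ((j + 1 : ℕ) : ℝ) * dctAngle (M + 1) k)) := by
    intro j _
    rw [dctVec_succ_sub]; ring
  rw [sum_congr rfl e1, ← mul_sum, Nat.add_sub_cancel, h, mul_sum, mul_sum]
  refine sum_congr rfl fun i _ => ?_
  have f1 : 2 * ((i + 1 : ℕ) : ℝ) * dctAngle (M + 1) k =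
    (2 * i + 1) * dctAngle (M + 1) k + dctAngle (M + 1) k := by push_cast; ring
  have f2 : 2 * (i : ℝ) * dctAngle (M + 1) k =
    (2 * i + 1) * dctAngle (M + 1) k - dctAngle (M + 1) k := by ring
  rw [f1, f2, sin_add, sin_sub]
  unfold pathEigenvalue dctVec
  ring

/-! ### The logarithmic lattice sum -/

/-- Enlarging the square adds a row, a column and a corner, each worth at most 1/(N + 1). The origin
contributes 0 through the convention 0⁻¹ = 0. -/
lemma sum_inv_sq_add_sq_le (N : ℕ) :
    ∑ k ∈ range (N + 1), ∑ l ∈ range (N + 1), ((k : ℝ) ^ 2 + (l : ℝ) ^ 2)⁻¹ ≤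
      3 * (harmonic N : ℝ) := by
  induction N with
  | zero => simp
  | succ N ih =>
    rw [harmonic_succ, sum_range_succ]
    simp_rw [sum_range_succ _ (N + 1)]
    rw [sum_add_distrib]
    have hb : ∀ k ∈ range (N + 1),
        ((k : ℝ) ^ 2 + ((N + 1 : ℕ) : ℝ) ^ 2)⁻¹ ≤ (((N + 1 : ℕ) : ℝ) ^ 2)⁻¹ := by
      intro k _
      gcongr
      linarith [sq_nonneg (k : ℝ)]
    have h1 := sum_le_card_nsmul _ _ _ hb
    have h2 : ∑ l ∈ range (N + 1), (((N + 1 : ℕ) : ℝ) ^ 2 + (l : ℝ) ^ 2)⁻¹ ≤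
      (N + 1) • (((N + 1 : ℕ) : ℝ) ^ 2)⁻¹ := by
      simp_rw [add_comm (((N + 1 : ℕ) : ℝ) ^ 2)]
      simpa using h1
    have h3 : (((N + 1 : ℕ) : ℝ) ^ 2 + ((N + 1 : ℕ) : ℝ) ^ 2)⁻¹ ≤ ((N + 1 : ℕ) : ℝ)⁻¹ := by
      gcongr
      have : (1 : ℝ) ≤ ((N + 1 : ℕ) : ℝ) := by exact_mod_cast Nat.succ_pos N
      nlinarith
    simp only [card_range, nsmul_eq_mul] at h1 h2
    have h4 : ((N + 1 : ℕ) : ℝ) * (((N + 1 : ℕ) : ℝ) ^ 2)⁻¹ = ((N + 1 : ℕ) : ℝ)⁻¹ := by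
      have : ((N + 1 : ℕ) : ℝ) ≠ 0 := by positivity
      field_simp
    rw [h4] at h1 h2
    push_cast at *
    linarith

lemma sum_inv_sq_add_sq_le_log {N : ℕ} (hN : 2 ≤ N) :
    ∑ k ∈ range N, ∑ l ∈ range N, ((k : ℝ) ^ 2 + (l : ℝ) ^ 2)⁻¹ ≤ 9 * log N := by
  obtain ⟨M, rfl⟩ : ∃ M, N = M + 1 := ⟨N - 1, by omega⟩
  refine (sum_inv_sq_add_sq_le M).trans ?_
  have h1 := harmonic_le_one_add_log M
  have h2 : log M ≤ log ((M + 1 : ℕ) : ℝ) :=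
    log_le_log (by exact_mod_cast (by omega : 0 < M)) (by push_cast; linarith)
  have h3 : log 2 ≤ log ((M + 1 : ℕ) : ℝ) := log_le_log (by norm_num) (by exact_mod_cast hN)
  have h4 := log_two_gt_d9
  linarith

/-! ### Grid gradient and its cosine eigenbasis -/

/-- The edges of the `N × N` grid. -/
abbrev GridEdge (N : ℕ) : Type := (Fin (N - 1) × Fin N) ⊕ (Fin N × Fin (N - 1))

/-- The discrete gradient `D θ`. -/
noncomputable def gridGradient {N : ℕ} (θ : Image N) (e : GridEdge N) : ℝ :=
  (gridIncidence N).mulVec θ.ofLp e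

/-- The lower endpoint of an edge of the path. -/
def edgeStart {N : ℕ} (j : Fin (N - 1)) : Fin N := ⟨j, by omega⟩

/-- The upper endpoint of an edge of the path. -/
def edgeEnd {N : ℕ} (j : Fin (N - 1)) : Fin N := ⟨j + 1, by omega⟩

lemma sum_pathIncidence_mul {N : ℕ} (j : Fin (N - 1)) (x : Fin N → ℝ) :
    ∑ i, pathIncidence N j i * x i = x (edgeEnd j) - x (edgeStart j) := by
  have h : ∀ i, pathIncidence N j i * x i =
      (if i = edgeEnd j then x i else 0) - (if i = edgeStart j then x i else 0) := by
    intro i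
    simp only [pathIncidence, Matrix.of_apply, edgeEnd, edgeStart, Fin.ext_iff]
    split_ifs <;> first | omega | simp
  simp_rw [h, sum_sub_distrib]
  simp

lemma gridGradient_inl {N : ℕ} (θ : Image N) (j : Fin (N - 1)) (i : Fin N) :
    gridGradient θ (Sum.inl (j, i)) = θ (edgeEnd j, i) - θ (edgeStart j, i) := by
  simp only [gridGradient, gridIncidence, Matrix.mulVec, dotProduct, Matrix.fromRows_apply_inl,
    Matrix.kroneckerMap_apply, Fintype.sum_prod_type, Matrix.one_apply]
  rw [← sum_pathIncidence_mul j fun a => θ (a, i)]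
  refine sum_congr rfl fun a _ => ?_
  simp

lemma gridGradient_inr {N : ℕ} (θ : Image N) (i : Fin N) (j : Fin (N - 1)) :
    gridGradient θ (Sum.inr (i, j)) = θ (i, edgeEnd j) - θ (i, edgeStart j) := by
  simp only [gridGradient, gridIncidence, Matrix.mulVec, dotProduct, Matrix.fromRows_apply_inr,
    Matrix.kroneckerMap_apply, Fintype.sum_prod_type, Matrix.one_apply]
  rw [← sum_pathIncidence_mul j fun a => θ (i, a), sum_eq_single i]
  · simp
  · intro b _ hb; simp [hb.symm]
  · simp

lemma gridGradient_add {N : ℕ} (x y : Image N) (e : GridEdge N) :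
    gridGradient (x + y) e = gridGradient x e + gridGradient y e := by
  simp [gridGradient, Matrix.mulVec_add]

lemma gridGradient_smul {N : ℕ} (t : ℝ) (x : Image N) (e : GridEdge N) :
    gridGradient (t • x) e = t * gridGradient x e := by
  simp [gridGradient, Matrix.mulVec_smul]

lemma gridGradient_sub {N : ℕ} (x y : Image N) (e : GridEdge N) :
    gridGradient (x - y) e = gridGradient x e - gridGradient y e := by
  simp [gridGradient, Matrix.mulVec_sub]

lemma totalVariation_eq {N : ℕ} (θ : Image N) : totalVariation θ = ∑ e, |gridGradient θ e| := rfl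

lemma sum_fin_mul_dctVec {N k l : ℕ} (hk : k < N) (hl : l < N) :
    ∑ i : Fin N, dctVec N k i * dctVec N l i = if k = l then 1 else 0 := by
  rw [Fin.sum_univ_eq_sum_range (fun i => dctVec N k i * dctVec N l i), sum_dctVec_mul hk hl]

lemma sum_fin_sub_mul_dctVec_sub {N : ℕ} (k : ℕ) (x : Fin N → ℝ) :
    ∑ j : Fin (N - 1), (x (edgeEnd j) - x (edgeStart j)) *
      (dctVec N k (j + 1) - dctVec N k j) =
      pathEigenvalue N k * ∑ i, x i * dctVec N k i := by
  rcases Nat.eq_zero_or_pos N with rfl | hN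
  · simp
  let y : ℕ → ℝ := fun i => if h : i < N then x ⟨i, h⟩ else 0
  have hy : ∀ i : Fin N, x i = y i := fun i => by simp [y]
  have h := sum_sub_mul_dctVec_sub hN k y
  rw [← Fin.sum_univ_eq_sum_range (fun i => y i * dctVec N k i),
    ← Fin.sum_univ_eq_sum_range
      (fun j => (y (j + 1) - y j) * (dctVec N k (j + 1) - dctVec N k j))] at h
  simp_rw [hy]
  exact h

/-- The two-dimensional discrete cosine transform vectors. -/
noncomputable def dctImage (N : ℕ) (p : Fin N × Fin N) : Image N :=
  WithLp.toLp 2 fun q => dctVec N p.1 q.1 * dctVec N p.2 q.2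

lemma inner_image {N : ℕ} (x y : Image N) : inner ℝ x y = ∑ a, ∑ b, x (a, b) * y (a, b) := by
  rw [PiLp.inner_apply, Fintype.sum_prod_type]
  simp [mul_comm]

lemma orthonormal_dctImage (N : ℕ) : Orthonormal ℝ (dctImage N) := by
  rw [orthonormal_iff_ite]
  rintro ⟨k, l⟩ ⟨k', l'⟩
  rw [inner_image]
  have : ∀ a b, dctImage N (k, l) (a, b) * dctImage N (k', l') (a, b) =
      (dctVec N k a * dctVec N k' a) * (dctVec N l b * dctVec N l' b) := by
    intro a b; simp only [dctImage]; ring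
  simp_rw [this, ← mul_sum, ← sum_mul]
  rw [sum_fin_mul_dctVec k.2 k'.2, sum_fin_mul_dctVec l.2 l'.2]
  simp only [Prod.mk.injEq, Fin.ext_iff, ite_and]
  split_ifs <;> simp

/-- The orthonormal basis of discrete cosines. -/
noncomputable def dctBasis (N : ℕ) : OrthonormalBasis (Fin N × Fin N) ℝ (Image N) :=
  OrthonormalBasis.mk (orthonormal_dctImage N)
    ((orthonormal_dctImage N).linearIndependent.span_eq_top_of_card_eq_finrank' (by simp)).ge

lemma dctBasis_apply (N : ℕ) (p : Fin N × Fin N) : dctBasis N p = dctImage N p := by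
  simp [dctBasis]

/-- The eigenvalues of the Laplacian of the grid. -/
noncomputable def gridEigenvalue {N : ℕ} (p : Fin N × Fin N) : ℝ :=
  pathEigenvalue N p.1 + pathEigenvalue N p.2

/-- Weak form of DᵀD u = μu: the path identity is applied along each column and each row. -/
lemma sum_gridGradient_mul_dctImage {N : ℕ} (p : Fin N × Fin N) (θ : Image N) :
    ∑ e, gridGradient θ e * gridGradient (dctImage N p) e =
      gridEigenvalue p * inner ℝ (dctImage N p) θ := by
  obtain ⟨k, l⟩ := p
  rw [Fintype.sum_sum_type, Fintype.sum_prod_type_right, Fintype.sum_prod_type, inner_image]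
  simp_rw [gridGradient_inl, gridGradient_inr]
  have h1 : ∀ i : Fin N, ∑ j : Fin (N - 1), (θ (edgeEnd j, i) - θ (edgeStart j, i)) *
      (dctImage N (k, l) (edgeEnd j, i) - dctImage N (k, l) (edgeStart j, i)) =
      dctVec N l i * (pathEigenvalue N k * ∑ a, θ (a, i) * dctVec N k a) := by
    intro i
    rw [← sum_fin_sub_mul_dctVec_sub k fun a => θ (a, i), mul_sum]
    refine sum_congr rfl fun j _ => ?_
    simp only [dctImage, edgeEnd, edgeStart]
    ring
  have h2 : ∀ i : Fin N, ∑ j : Fin (N - 1), (θ (i, edgeEnd j) - θ (i, edgeStart j)) *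
      (dctImage N (k, l) (i, edgeEnd j) - dctImage N (k, l) (i, edgeStart j)) =
      dctVec N k i * (pathEigenvalue N l * ∑ a, θ (i, a) * dctVec N l a) := by
    intro i
    rw [← sum_fin_sub_mul_dctVec_sub l fun a => θ (i, a), mul_sum]
    refine sum_congr rfl fun j _ => ?_
    simp only [dctImage, edgeEnd, edgeStart]
    ring
  simp_rw [h1, h2, mul_sum]
  rw [sum_comm, ← sum_add_distrib]
  refine sum_congr rfl fun a _ => ?_
  rw [← sum_add_distrib]
  refine sum_congr rfl fun b _ => ?_
  simp only [dctImage, gridEigenvalue]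
  ring

lemma gridGradient_dctImage_sq_le {N : ℕ} (p : Fin N × Fin N) (e : GridEdge N) :
    gridGradient (dctImage N p) e ^ 2 ≤ gridEigenvalue p * (4 / (N : ℝ) ^ 2) := by
  obtain ⟨k, l⟩ := p
  have key : ∀ k l j i : ℕ, ((dctVec N k (j + 1) - dctVec N k j) * dctVec N l i) ^ 2 ≤
      pathEigenvalue N k * (4 / (N : ℝ) ^ 2) := by
    intro k l j i
    rw [mul_pow]
    have := mul_le_mul (dctVec_succ_sub_sq_le N k j) (dctVec_sq_le N l i) (sq_nonneg _)
      (mul_nonneg (pathEigenvalue_nonneg N k) (by positivity))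
    refine this.trans_eq ?_
    ring
  have hp : (0 : ℝ) ≤ 4 / (N : ℝ) ^ 2 := by positivity
  have hk := mul_nonneg (pathEigenvalue_nonneg N k) hp
  have hl := mul_nonneg (pathEigenvalue_nonneg N l) hp
  rcases e with ⟨j, i⟩ | ⟨i, j⟩
  · rw [gridGradient_inl]
    have h := key k l j i
    have e1 : dctImage N (k, l) (edgeEnd j, i) - dctImage N (k, l) (edgeStart j, i) =
        (dctVec N k (j + 1) - dctVec N k j) * dctVec N l i := by
      simp only [dctImage, edgeEnd, edgeStart]; ring
    rw [e1, gridEigenvalue, add_mul]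
    linarith
  · rw [gridGradient_inr]
    have h := key l k j i
    have e1 : dctImage N (k, l) (i, edgeEnd j) - dctImage N (k, l) (i, edgeStart j) =
        (dctVec N l (j + 1) - dctVec N l j) * dctVec N k i := by
      simp only [dctImage, edgeEnd, edgeStart]; ring
    rw [e1, gridEigenvalue, add_mul]
    linarith

lemma le_gridEigenvalue {N : ℕ} (p : Fin N × Fin N) :
    4 / (N : ℝ) ^ 2 * ((p.1 : ℝ) ^ 2 + (p.2 : ℝ) ^ 2) ≤ gridEigenvalue p := by
  have h1 := le_pathEigenvalue p.1.2
  have h2 := le_pathEigenvalue p.2.2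
  unfold gridEigenvalue
  calc _ = 4 * (p.1 : ℝ) ^ 2 / (N : ℝ) ^ 2 + 4 * (p.2 : ℝ) ^ 2 / (N : ℝ) ^ 2 := by ring
    _ ≤ _ := add_le_add h1 h2

lemma gridGradient_dctImage_zero {N : ℕ} (hN : 0 < N) (e : GridEdge N) :
    gridGradient (dctImage N (⟨0, hN⟩, ⟨0, hN⟩)) e = 0 := by
  have h := gridGradient_dctImage_sq_le (⟨0, hN⟩, ⟨0, hN⟩) e
  simp only [gridEigenvalue, pathEigenvalue, dctAngle] at h
  simp only [Nat.cast_zero, mul_zero, zero_div, sin_zero] at h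
  exact pow_eq_zero_iff two_ne_zero |>.mp (le_antisymm (by simpa using h) (sq_nonneg _))

/-! ### Pseudoinverse of the grid incidence matrix -/

/-- The column of the pseudoinverse of the grid incidence matrix indexed by the edge `e`. -/
noncomputable def pinvColumn {N : ℕ} (e : GridEdge N) : Image N :=
  ∑ p, (gridGradient (dctImage N p) e / gridEigenvalue p) • dctBasis N p

lemma gridEigenvalue_pos {N : ℕ} (hN : 0 < N) {p : Fin N × Fin N}
    (hp : p ≠ (⟨0, hN⟩, ⟨0, hN⟩)) : 0 < gridEigenvalue p := by
  refine lt_of_lt_of_le ?_ (le_gridEigenvalue p)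
  have hN' : (0 : ℝ) < N := by exact_mod_cast hN
  refine mul_pos (by positivity) ?_
  by_contra h
  have h1 : (p.1 : ℝ) = 0 := by nlinarith [sq_nonneg (p.1 : ℝ), sq_nonneg (p.2 : ℝ)]
  have h2 : (p.2 : ℝ) = 0 := by nlinarith [sq_nonneg (p.1 : ℝ), sq_nonneg (p.2 : ℝ)]
  apply hp
  ext
  · exact_mod_cast h1
  · exact_mod_cast h2

/-- By Parseval and delocalization, mode (k, l) with eigenvalue μ contributes at most (4/N²)/μ ≤
1/(k² + l²). -/
lemma norm_pinvColumn_sq_le {N : ℕ} (hN : 2 ≤ N) (e : GridEdge N) :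
    ‖pinvColumn e‖ ^ 2 ≤ 9 * log N := by
  have hN0 : 0 < N := by omega
  have hN' : (0 : ℝ) < N := by exact_mod_cast hN0
  have h1 : ‖pinvColumn e‖ ^ 2 =
      ∑ p, (gridGradient (dctImage N p) e / gridEigenvalue p) ^ 2 := by
    rw [← (dctBasis N).repr.norm_map, EuclideanSpace.real_norm_sq_eq]
    refine sum_congr rfl fun p _ => ?_
    congr 1
    rw [OrthonormalBasis.repr_apply_apply, pinvColumn,
      (dctBasis N).orthonormal.inner_right_fintype]
  rw [h1]
  have h2 : ∀ p : Fin N × Fin N, (gridGradient (dctImage N p) e / gridEigenvalue p) ^ 2 ≤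
      ((p.1 : ℝ) ^ 2 + (p.2 : ℝ) ^ 2)⁻¹ := by
    intro p
    by_cases hp : p = (⟨0, hN0⟩, ⟨0, hN0⟩)
    · subst hp; rw [gridGradient_dctImage_zero]; simp
    · have hpos := gridEigenvalue_pos hN0 hp
      have hle := le_gridEigenvalue p
      have hsq := gridGradient_dctImage_sq_le p e
      have hq : 0 < (p.1 : ℝ) ^ 2 + (p.2 : ℝ) ^ 2 := by
        by_contra h
        have h1 : (p.1 : ℝ) = 0 := by nlinarith [sq_nonneg (p.1 : ℝ), sq_nonneg (p.2 : ℝ)]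
        have h2 : (p.2 : ℝ) = 0 := by nlinarith [sq_nonneg (p.1 : ℝ), sq_nonneg (p.2 : ℝ)]
        apply hp
        ext
        · exact_mod_cast h1
        · exact_mod_cast h2
      rw [div_pow, div_le_iff₀ (by positivity), ← div_eq_inv_mul, le_div_iff₀ hq]
      calc _ ≤ gridEigenvalue p * (4 / (N : ℝ) ^ 2) * ((p.1 : ℝ) ^ 2 + (p.2 : ℝ) ^ 2) := by gcongr
        _ = gridEigenvalue p * (4 / (N : ℝ) ^ 2 * ((p.1 : ℝ) ^ 2 + (p.2 : ℝ) ^ 2)) := by ring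
        _ ≤ gridEigenvalue p * gridEigenvalue p := by gcongr
        _ = _ := by ring
  refine (sum_le_sum fun p _ => h2 p).trans ?_
  rw [Fintype.sum_prod_type]
  refine le_trans (le_of_eq ?_) (sum_inv_sq_add_sq_le_log hN)
  rw [← Fin.sum_univ_eq_sum_range
    (fun k => ∑ l ∈ range N, ((k : ℝ) ^ 2 + (l : ℝ) ^ 2)⁻¹)]
  refine sum_congr rfl fun k _ => ?_
  rw [← Fin.sum_univ_eq_sum_range (fun l => (((k : ℕ) : ℝ) ^ 2 + (l : ℝ) ^ 2)⁻¹)]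

/-- D⁺D is the projection orthogonal to constants; the zero mode, where the eigenvalue cannot be
cancelled, is split off. -/
lemma inner_eq_add_sum_pinvColumn {N : ℕ} (hN : 0 < N) (x θ : Image N) :
    inner ℝ x θ = inner ℝ (dctBasis N (⟨0, hN⟩, ⟨0, hN⟩)) x *
        inner ℝ (dctBasis N (⟨0, hN⟩, ⟨0, hN⟩)) θ +
      ∑ e, gridGradient θ e * inner ℝ (pinvColumn e) x := by
  set z : Fin N × Fin N := (⟨0, hN⟩, ⟨0, hN⟩) with hz
  have h1 : ∀ e : GridEdge N, gridGradient θ e * inner ℝ (pinvColumn e) x =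
      ∑ p, gridGradient θ e * gridGradient (dctImage N p) e *
        (inner ℝ (dctBasis N p) x / gridEigenvalue p) := by
    intro e
    rw [pinvColumn, sum_inner, mul_sum]
    refine sum_congr rfl fun p _ => ?_
    rw [real_inner_smul_left]
    ring
  simp_rw [h1]
  rw [sum_comm]
  simp_rw [← sum_mul, sum_gridGradient_mul_dctImage]
  rw [← (dctBasis N).sum_inner_mul_inner x θ, ← add_sum_erase _ _ (mem_univ z),
    ← add_sum_erase _ (fun p => gridEigenvalue p * inner ℝ (dctImage N p) θ *
        (inner ℝ (dctBasis N p) x / gridEigenvalue p)) (mem_univ z)]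
  have h0 : gridEigenvalue z = 0 := by simp [gridEigenvalue, pathEigenvalue, dctAngle, hz]
  rw [h0, real_inner_comm]
  simp only [zero_mul, zero_add]
  congr 1
  refine sum_congr rfl fun p hp => ?_
  have := (gridEigenvalue_pos hN (ne_of_mem_erase hp)).ne'
  rw [dctBasis_apply, real_inner_comm]
  field_simp

/-! ### Gaussian tails of linear functionals of the noise -/

open scoped NNReal

lemma hasSubgaussianMGF_inner_of_hasLaw {ι Ω : Type*} [Fintype ι] [DecidableEq ι]
    [MeasurableSpace Ω] {P : Measure Ω} {ε : Ω → EuclideanSpace ℝ ι} {σ : ℝ}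
    (hε : HasLaw ε (multivariateGaussian 0 (σ ^ 2 • (1 : Matrix ι ι ℝ))) P)
    (v : EuclideanSpace ℝ ι) :
    HasSubgaussianMGF (fun ω => inner ℝ v (ε ω)) (σ ^ 2 * ‖v‖ ^ 2).toNNReal P := by
  set μ := multivariateGaussian 0 (σ ^ 2 • (1 : Matrix ι ι ℝ)) with hμ
  have hS : (σ ^ 2 • (1 : Matrix ι ι ℝ)).PosSemidef := Matrix.PosSemidef.one.smul (sq_nonneg σ)
  have hvar : Var[fun u => inner ℝ v u; μ] = σ ^ 2 * ‖v‖ ^ 2 := by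
    rw [← covarianceBilin_self IsGaussian.memLp_two_id, hμ, covarianceBilin_multivariateGaussian hS,
      Matrix.smul_mulVec, Matrix.one_mulVec, dotProduct_smul, smul_eq_mul,
      EuclideanSpace.real_norm_sq_eq]
    simp [dotProduct, sq]
  have hmean : ∫ u, inner ℝ v u ∂μ = 0 := by
    have h := integral_inner (𝕜 := ℝ) (μ := μ) (f := fun u => u) IsGaussian.integrable_id v
    rw [h, hμ, integral_id_multivariateGaussian, inner_zero_right]
  have hmap : μ.map (fun u => inner ℝ v u) = gaussianReal 0 (σ ^ 2 * ‖v‖ ^ 2).toNNReal := by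
    have h := (IsGaussian.hasGaussianLaw_id (μ := μ)).map_fun (innerSL ℝ v)
    have h' := h.map_eq_gaussianReal
    simp only [id, innerSL_apply_apply] at h'
    rw [h', hvar, hmean]
  have hmeas : Measurable fun u : EuclideanSpace ℝ ι => inner ℝ v u := by fun_prop
  have hmapP : P.map (fun ω => inner ℝ v (ε ω)) = gaussianReal 0 (σ ^ 2 * ‖v‖ ^ 2).toNNReal := by
    rw [← hmap, ← hε.map_eq, AEMeasurable.map_map_of_aemeasurable hmeas.aemeasurable
      hε.aemeasurable]
    rfl
  have hae : AEMeasurable (fun ω => inner ℝ v (ε ω)) P := hmeas.comp_aemeasurable hε.aemeasurable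
  constructor
  · intro t
    have h := integrable_exp_mul_gaussianReal (μ := 0) (v := (σ ^ 2 * ‖v‖ ^ 2).toNNReal) t
    rw [← hmapP] at h
    exact h.comp_aemeasurable hae
  · intro t
    rw [mgf_gaussianReal hmapP]
    simp

lemma measureReal_lt_abs_le {Ω : Type*} [MeasurableSpace Ω] {P : Measure Ω}
    [IsProbabilityMeasure P] {X : Ω → ℝ} {c : ℝ≥0} (hX : HasSubgaussianMGF X c P) {s t : ℝ}
    (hs : 0 ≤ s) (ht : √c * s ≤ t) :
    P.real {ω | t < |X ω|} ≤ 2 * exp (-s ^ 2 / 2) := by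
  have hcs : 0 ≤ √(c : ℝ) * s := by positivity
  rcases eq_or_ne c 0 with rfl | hc
  -- At zero variance the Chernoff exponent degenerates, but X = 0 almost surely and t ≥ 0, so the
  -- strict event is null.
  · have h0 := hX.ae_eq_zero_of_hasSubgaussianMGF_zero
    have : P {ω | t < |X ω|} = 0 := by
      rw [← compl_compl {ω | t < |X ω|}, ← mem_ae_iff]
      filter_upwards [h0] with ω hω
      simp only [Set.mem_compl_iff, Set.mem_ofPred_eq, hω, not_lt, Pi.zero_apply, abs_zero]
      linarith
    rw [Measure.real, this]
    simp only [ENNReal.toReal_zero]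
    positivity
  · have hc' : (0 : ℝ) < c := by exact_mod_cast pos_iff_ne_zero.mpr hc
    have hsub : {ω | t < |X ω|} ⊆ {ω | √c * s ≤ X ω} ∪ {ω | √c * s ≤ (-X) ω} := by
      intro ω hω
      simp only [Set.mem_ofPred_eq, Set.mem_union, Pi.neg_apply] at *
      rcases lt_abs.mp hω with h | h
      · left; linarith
      · right; linarith
    have h1 := hX.measure_ge_le hcs
    have h2 := hX.neg.measure_ge_le hcs
    have e : -(√(c : ℝ) * s) ^ 2 / (2 * c) = -s ^ 2 / 2 := by
      rw [mul_pow, sq_sqrt hc'.le]; field_simp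
    rw [e] at h1 h2
    calc _ ≤ _ := measureReal_mono hsub
      _ ≤ _ := measureReal_union_le _ _
      _ ≤ _ := by linarith

lemma measureReal_lt_abs_inner_le {ι Ω : Type*} [Fintype ι] [DecidableEq ι]
    [MeasurableSpace Ω] {P : Measure Ω} [IsProbabilityMeasure P]
    {ε : Ω → EuclideanSpace ℝ ι} {σ : ℝ} (hσ : 0 ≤ σ)
    (hε : HasLaw ε (multivariateGaussian 0 (σ ^ 2 • (1 : Matrix ι ι ℝ))) P)
    (v : EuclideanSpace ℝ ι) {η t : ℝ} (hη : 0 < η) (hη2 : η ≤ 2)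
    (ht : σ * ‖v‖ * √(2 * log (2 / η)) ≤ t) :
    P.real {ω | t < |inner ℝ v (ε ω)|} ≤ η := by
  have hlog : 0 ≤ log (2 / η) := log_nonneg (by rw [le_div_iff₀ hη]; linarith)
  refine (measureReal_lt_abs_le (hasSubgaussianMGF_inner_of_hasLaw hε v)
    (sqrt_nonneg (2 * log (2 / η))) (t := t) ?_).trans_eq ?_
  · rw [coe_toNNReal _ (by positivity), ← mul_pow, sqrt_sq (by positivity)]
    exact ht
  · rw [sq_sqrt (by positivity)]
    have : -(2 * log (2 / η)) / 2 = -log (2 / η) := by ring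
    rw [this, exp_neg, exp_log (by positivity)]
    field_simp

/-! ### Total variation: bi-isotonic images and convexity -/

lemma sum_edgeEnd_sub_edgeStart {N : ℕ} (hN : 0 < N) (x : Fin N → ℝ) :
    ∑ j : Fin (N - 1), (x (edgeEnd j) - x (edgeStart j)) =
      x ⟨N - 1, Nat.sub_lt hN Nat.one_pos⟩ - x ⟨0, hN⟩ := by
  let y : ℕ → ℝ := fun i => if h : i < N then x ⟨i, h⟩ else 0
  have hy : ∀ i : Fin N, x i = y i := fun i => by simp [y]
  simp_rw [hy]
  exact (Fin.sum_univ_eq_sum_range (fun j => y (j + 1) - y j) (N - 1)).trans (sum_range_sub y _)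

/-- On each of the 2N rows and columns the increments are nonnegative and telescope to at most the
corner difference. -/
lemma totalVariation_le_of_mem_biIsotonic {N : ℕ} (hN : 0 < N) {θ : Image N}
    (hθ : θ ∈ biIsotonic N) : totalVariation θ ≤ 2 * N * √(squareVariation hN θ) := by
  have hθ' : ∀ i₁ i₂ j₁ j₂ : Fin N, i₁ ≤ j₁ → i₂ ≤ j₂ → θ (i₁, i₂) ≤ θ (j₁, j₂) := hθ
  have hse : ∀ j : Fin (N - 1), edgeStart j ≤ edgeEnd j := fun j => by
    simp [edgeStart, edgeEnd]
  set L : Fin N := ⟨N - 1, Nat.sub_lt hN Nat.one_pos⟩ with hL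
  set Z : Fin N := ⟨0, hN⟩ with hZ
  have hle : ∀ i : Fin N, i ≤ L := fun i => by rw [Fin.le_def]; simp only [hL]; omega
  have hge : ∀ i : Fin N, Z ≤ i := fun i => by rw [Fin.le_def]; simp [hZ]
  have hV : √(squareVariation hN θ) = θ (L, L) - θ (Z, Z) := by
    rw [squareVariation, sqrt_sq]
    exact sub_nonneg.mpr (hθ' _ _ _ _ (hge _) (hge _))
  rw [totalVariation_eq, Fintype.sum_sum_type, Fintype.sum_prod_type_right,
    Fintype.sum_prod_type, hV]
  have h1 : ∀ i : Fin N, ∑ j, |gridGradient θ (Sum.inl (j, i))| ≤ θ (L, L) - θ (Z, Z) := by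
    intro i
    have : ∀ j, |gridGradient θ (Sum.inl (j, i))| = θ (edgeEnd j, i) - θ (edgeStart j, i) := by
      intro j
      rw [gridGradient_inl, abs_of_nonneg (sub_nonneg.mpr (hθ' _ _ _ _ (hse j) le_rfl))]
    simp_rw [this]
    rw [sum_edgeEnd_sub_edgeStart hN fun a => θ (a, i)]
    exact sub_le_sub (hθ' _ _ _ _ le_rfl (hle i)) (hθ' _ _ _ _ le_rfl (hge i))
  have h2 : ∀ i : Fin N, ∑ j, |gridGradient θ (Sum.inr (i, j))| ≤ θ (L, L) - θ (Z, Z) := by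
    intro i
    have : ∀ j, |gridGradient θ (Sum.inr (i, j))| = θ (i, edgeEnd j) - θ (i, edgeStart j) := by
      intro j
      rw [gridGradient_inr, abs_of_nonneg (sub_nonneg.mpr (hθ' _ _ _ _ le_rfl (hse j)))]
    simp_rw [this]
    rw [sum_edgeEnd_sub_edgeStart hN fun a => θ (i, a)]
    exact sub_le_sub (hθ' _ _ _ _ (hle i) le_rfl) (hθ' _ _ _ _ (hge i) le_rfl)
  have h3 := sum_le_card_nsmul univ _ _ fun i _ => h1 i
  have h4 := sum_le_card_nsmul univ _ _ fun i _ => h2 i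
  simp only [card_univ, Fintype.card_fin, nsmul_eq_mul] at h3 h4
  linarith

lemma totalVariation_sub_le {N : ℕ} (x y : Image N) :
    totalVariation (x - y) ≤ totalVariation x + totalVariation y := by
  simp_rw [totalVariation_eq, ← sum_add_distrib, gridGradient_sub]
  exact sum_le_sum fun e _ => abs_sub _ _

lemma totalVariation_convexComb_le {N : ℕ} (x y : Image N) {t : ℝ} (h0 : 0 ≤ t) (h1 : t ≤ 1) :
    totalVariation (x + t • (y - x)) ≤ (1 - t) * totalVariation x + t * totalVariation y := by
  simp_rw [totalVariation_eq, mul_sum, ← sum_add_distrib]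
  refine sum_le_sum fun e _ => ?_
  rw [gridGradient_add, gridGradient_smul, gridGradient_sub]
  calc _ = |(1 - t) * gridGradient x e + t * gridGradient y e| := by congr 1; ring
    _ ≤ _ := abs_add_le _ _
    _ = _ := by rw [abs_mul, abs_mul, abs_of_nonneg h0, abs_of_nonneg (sub_nonneg.mpr h1)]

/-! ### Optimality condition and oracle inequality -/

/-- First-order optimality along the segment from θhat to θ; convexity of TV stands in for a
subgradient. -/
lemma IsTVDenoiser.two_mul_inner_le {N : ℕ} (hN : 0 < N) {y θhat : Image N} {lam : ℝ}
    (hlam : 0 ≤ lam) (h : IsTVDenoiser y lam θhat) (θ : Image N) :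
    0 ≤ 2 * inner ℝ (θhat - y) (θ - θhat) +
      (N : ℝ) ^ 2 * lam * (totalVariation θ - totalVariation θhat) := by
  have hN' : (0 : ℝ) < (N : ℝ) ^ 2 := by positivity
  set A := 2 * inner ℝ (θhat - y) (θ - θhat) +
      (N : ℝ) ^ 2 * lam * (totalVariation θ - totalVariation θhat) with hA
  have key : ∀ t : ℝ, 0 < t → t ≤ 1 → 0 ≤ A + t * ‖θ - θhat‖ ^ 2 := by
    intro t ht ht1
    have h1 : tvObjective y lam θhat ≤ tvObjective y lam (θhat + t • (θ - θhat)) :=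
      h (Set.mem_univ _)
    unfold tvObjective at h1
    have h2 := mul_le_mul_of_nonneg_left (totalVariation_convexComb_le θhat θ ht.le ht1) hlam
    have h3 : ‖θhat + t • (θ - θhat) - y‖ ^ 2 =
        ‖θhat - y‖ ^ 2 + 2 * (t * inner ℝ (θhat - y) (θ - θhat)) + t ^ 2 * ‖θ - θhat‖ ^ 2 := by
      have : θhat + t • (θ - θhat) - y = (θhat - y) + t • (θ - θhat) := by abel
      rw [this, norm_add_sq_real, real_inner_smul_right, norm_smul, mul_pow, norm_eq_abs, sq_abs]
    rw [h3] at h1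
    have h4 : 0 ≤ 1 / (N : ℝ) ^ 2 *
        (2 * (t * inner ℝ (θhat - y) (θ - θhat)) + t ^ 2 * ‖θ - θhat‖ ^ 2) +
        lam * (t * (totalVariation θ - totalVariation θhat)) := by linarith
    have h5 := mul_nonneg hN'.le h4
    have h6 : (N : ℝ) ^ 2 * (1 / (N : ℝ) ^ 2 *
        (2 * (t * inner ℝ (θhat - y) (θ - θhat)) + t ^ 2 * ‖θ - θhat‖ ^ 2) +
        lam * (t * (totalVariation θ - totalVariation θhat))) =
        t * (A + t * ‖θ - θhat‖ ^ 2) := by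
      rw [hA]; field_simp; ring
    rw [h6] at h5
    exact nonneg_of_mul_nonneg_right h5 ht
  by_contra hneg
  push Not at hneg
  set B := ‖θ - θhat‖ ^ 2 with hB
  have hB0 : 0 ≤ B := sq_nonneg _
  -- A step this short keeps tB ≤ -A/2, forcing A + tB < 0; the +1 covers B = 0.
  have h1 := key (min 1 (-A / (2 * (B + 1)))) (lt_min one_pos (by
    apply div_pos <;> linarith)) (min_le_left _ _)
  have h2 := mul_le_mul_of_nonneg_right (min_le_right 1 (-A / (2 * (B + 1)))) hB0
  have h3 : -A / (2 * (B + 1)) * B ≤ -A / 2 := by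
    rw [div_mul_eq_mul_div, div_le_div_iff₀ (by linarith) two_pos]
    nlinarith
  linarith

lemma IsTVDenoiser.sq_dist_add_le {N : ℕ} (hN : 0 < N) {θstar ε θhat : Image N} {lam : ℝ}
    (hlam : 0 ≤ lam) (h : IsTVDenoiser (θstar + ε) lam θhat) (θ : Image N) :
    ‖θhat - θstar‖ ^ 2 + ‖θhat - θ‖ ^ 2 ≤ ‖θ - θstar‖ ^ 2 + 2 * inner ℝ ε (θhat - θ) +
      (N : ℝ) ^ 2 * lam * (totalVariation θ - totalVariation θhat) := by
  have h1 := h.two_mul_inner_le hN hlam θ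
  have e1 : θhat - (θstar + ε) = (θhat - θstar) - ε := by abel
  have e2 : θ - θstar = (θhat - θstar) - (θhat - θ) := by abel
  have e3 : θ - θhat = -(θhat - θ) := by abel
  rw [e1, e3, inner_neg_right, inner_sub_left] at h1
  rw [e2, norm_sub_sq_real (θhat - θstar) (θhat - θ)]
  linarith

/-- Oracle inequality on the event that the noise is dominated by the regularization. -/
lemma IsTVDenoiser.sq_dist_le {N : ℕ} (hN : 0 < N) {θstar ε θhat : Image N} {lam : ℝ}
    (hlam : 0 ≤ lam) (h : IsTVDenoiser (θstar + ε) lam θhat)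
    (hnoise : ∀ e : GridEdge N, |inner ℝ (pinvColumn e) ε| ≤ (N : ℝ) ^ 2 * lam / 2)
    (θ : Image N) :
    ‖θhat - θstar‖ ^ 2 ≤ ‖θ - θstar‖ ^ 2 + inner ℝ (dctBasis N (⟨0, hN⟩, ⟨0, hN⟩)) ε ^ 2 +
      2 * ((N : ℝ) ^ 2 * lam) * totalVariation θ := by
  have h1 := h.sq_dist_add_le hN hlam θ
  rw [inner_eq_add_sum_pinvColumn hN ε] at h1
  set w := dctBasis N (⟨0, hN⟩, ⟨0, hN⟩) with hw
  have hwn : ‖w‖ = 1 := (dctBasis N).norm_eq_one _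
  have h2 : ∑ e, gridGradient (θhat - θ) e * inner ℝ (pinvColumn e) ε ≤
      totalVariation (θhat - θ) * ((N : ℝ) ^ 2 * lam / 2) := by
    rw [totalVariation_eq, sum_mul]
    refine sum_le_sum fun e _ => (le_abs_self _).trans ?_
    rw [abs_mul]
    exact mul_le_mul_of_nonneg_left (hnoise e) (abs_nonneg _)
  have h3 := mul_le_mul_of_nonneg_right (totalVariation_sub_le θhat θ)
    (show 0 ≤ (N : ℝ) ^ 2 * lam / 2 by positivity)
  have h4 : inner ℝ w (θhat - θ) ^ 2 ≤ ‖θhat - θ‖ ^ 2 := by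
    rw [← sq_abs]
    have := abs_real_inner_le_norm w (θhat - θ)
    rw [hwn, one_mul] at this
    exact pow_le_pow_left₀ (abs_nonneg _) this 2
  -- The constant mode enters as 2ab ≤ a² + b², with b² ≤ ‖θhat - θ‖² cancelling on the left; TV
  -- θhat cancels against the penalty.
  nlinarith [sq_nonneg (inner ℝ w ε - inner ℝ w (θhat - θ))]

/-! ### The noise event and the final constants -/

lemma card_gridEdge_le (N : ℕ) : (Fintype.card (GridEdge N) : ℝ) ≤ 2 * (N : ℝ) ^ 2 := by
  have : Fintype.card (GridEdge N) ≤ 2 * N ^ 2 := by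
    simp only [Fintype.card_sum, Fintype.card_prod, Fintype.card_fin]
    have := Nat.mul_le_mul_right N (Nat.sub_le N 1)
    have := Nat.mul_le_mul_left N (Nat.sub_le N 1)
    nlinarith
  exact_mod_cast this

lemma measureReal_noise_event {N : ℕ} (hN : 0 < N) {Ω : Type*} [MeasurableSpace Ω]
    {P : Measure Ω} [IsProbabilityMeasure P] {ε : Ω → Image N} {σ δ : ℝ} (hσ : 0 ≤ σ)
    (hδ : δ ∈ Set.Ioo (0 : ℝ) 1)
    (hε : HasLaw ε (multivariateGaussian 0
      (σ ^ 2 • (1 : Matrix (Fin N × Fin N) (Fin N × Fin N) ℝ))) P) :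
    P.real ({ω | ∀ e : GridEdge N, |inner ℝ (pinvColumn e) (ε ω)| ≤
        (N : ℝ) ^ 2 * tvParameter 10 σ δ ((N : ℝ) ^ 2) / 2} ∩
      {ω | |inner ℝ (dctBasis N (⟨0, hN⟩, ⟨0, hN⟩)) (ε ω)| ≤ σ * √(2 * log (2 / δ))})ᶜ ≤
      2 * δ := by
  obtain ⟨hδ0, hδ1⟩ := hδ
  have hN' : (0 : ℝ) < N := by exact_mod_cast hN
  have hN1 : (1 : ℝ) ≤ N := by exact_mod_cast hN
  set t := (N : ℝ) ^ 2 * tvParameter 10 σ δ ((N : ℝ) ^ 2) / 2 with ht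
  -- Union bound budget: at most 2N² edges share one δ, and the constant mode takes the other.
  set η := δ / (2 * (N : ℝ) ^ 2) with hη
  have hη0 : 0 < η := by positivity
  have hη2 : η ≤ 2 := by
    rw [hη, div_le_iff₀ (by positivity)]; nlinarith
  have hedge : ∀ e : GridEdge N, P.real {ω | t < |inner ℝ (pinvColumn e) (ε ω)|} ≤ η := by
    intro e
    refine measureReal_lt_abs_inner_le hσ hε _ hη0 hη2 ?_
    have hN2 : 2 ≤ N := by
      rcases e with ⟨j, -⟩ | ⟨-, j⟩ <;> have := j.2 <;> omega
    have hlogN : 0 ≤ log N := log_nonneg hN1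
    have h1 := norm_pinvColumn_sq_le hN2 e
    have h2 : log (2 / η) ≤ 2 * log (exp 1 * (N : ℝ) ^ 2 / δ) := by
      have : 2 * log (exp 1 * (N : ℝ) ^ 2 / δ) = log ((exp 1 * (N : ℝ) ^ 2 / δ) ^ 2) := by
        rw [log_pow]; norm_num
      rw [this]
      apply log_le_log (by positivity)
      have he : 2 ≤ exp 1 := by have := exp_one_gt_d9; linarith
      have hx : 1 ≤ (N : ℝ) ^ 2 / δ := by
        rw [le_div_iff₀ hδ0]; nlinarith
      calc 2 / η = 4 * ((N : ℝ) ^ 2 / δ) := by rw [hη]; field_simp; norm_num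
        _ ≤ exp 1 ^ 2 * ((N : ℝ) ^ 2 / δ) ^ 2 := by
          apply mul_le_mul (by nlinarith) (by nlinarith) (by positivity) (by positivity)
        _ = _ := by ring
    have h3 : 0 ≤ log (2 / η) := log_nonneg (by rw [le_div_iff₀ hη0]; linarith)
    -- With L = log(en/δ), the squared left side is at most 9 log N · 4L = 36 L log N, below 25 · 2
    -- log N · L. Hence the 5, and c = 10 since the threshold is nλ/2.
    have h4 : ‖pinvColumn e‖ * √(2 * log (2 / η)) ≤
        5 * √(log ((N : ℝ) ^ 2) * log (exp 1 * (N : ℝ) ^ 2 / δ)) := by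
      refine (pow_le_pow_iff_left₀ (by positivity) (by positivity) two_ne_zero).mp ?_
      · rw [mul_pow, mul_pow, sq_sqrt (by positivity), log_pow, sq_sqrt]
        · push_cast
          nlinarith [mul_le_mul h1 h2 h3 (by positivity),
            mul_nonneg hlogN (h3.trans h2)]
        · have := h3.trans h2
          push_cast
          apply mul_nonneg <;> linarith
    have h5 : t = σ * (5 * √(log ((N : ℝ) ^ 2) * log (exp 1 * (N : ℝ) ^ 2 / δ))) := by
      rw [ht, tvParameter]; field_simp; ring
    rw [h5, mul_assoc]
    exact mul_le_mul_of_nonneg_left h4 hσ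
  have hmean : P.real {ω | σ * √(2 * log (2 / δ)) <
      |inner ℝ (dctBasis N (⟨0, hN⟩, ⟨0, hN⟩)) (ε ω)|} ≤ δ := by
    refine measureReal_lt_abs_inner_le hσ hε _ hδ0 (by linarith) ?_
    rw [(dctBasis N).norm_eq_one, mul_one]
  have hsub : ({ω | ∀ e : GridEdge N, |inner ℝ (pinvColumn e) (ε ω)| ≤ t} ∩
      {ω | |inner ℝ (dctBasis N (⟨0, hN⟩, ⟨0, hN⟩)) (ε ω)| ≤ σ * √(2 * log (2 / δ))})ᶜ ⊆
      (⋃ e : GridEdge N, {ω | t < |inner ℝ (pinvColumn e) (ε ω)|}) ∪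
      {ω | σ * √(2 * log (2 / δ)) <
        |inner ℝ (dctBasis N (⟨0, hN⟩, ⟨0, hN⟩)) (ε ω)|} := by
    intro ω hω
    simp only [Set.mem_compl_iff, Set.mem_inter_iff, Set.mem_ofPred_eq, Set.mem_union,
      Set.mem_iUnion, not_and_or, not_forall, not_le] at *
    exact hω
  have hunion : P.real (⋃ e : GridEdge N, {ω | t < |inner ℝ (pinvColumn e) (ε ω)|}) ≤ δ := by
    refine (measureReal_iUnion_fintype_le _).trans ?_
    refine (sum_le_card_nsmul _ _ _ fun e _ => hedge e).trans ?_
    rw [nsmul_eq_mul, card_univ]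
    refine (mul_le_mul_of_nonneg_right (card_gridEdge_le N) hη0.le).trans_eq ?_
    rw [hη]; field_simp
  calc _ ≤ _ := measureReal_mono hsub
    _ ≤ _ := measureReal_union_le _ _
    _ ≤ _ := by linarith

lemma tvParameter_mul_le {N : ℕ} (hN : 0 < N) {σ δ : ℝ} (hσ : 0 ≤ σ)
    (hδ : δ ∈ Set.Ioo (0 : ℝ) 1) :
    4 * N * tvParameter 10 σ δ ((N : ℝ) ^ 2) ≤
      60 * σ * √(log ((N : ℝ) ^ 2) * log ((N : ℝ) ^ 2 / δ) / (N : ℝ) ^ 2) := by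
  obtain ⟨hδ0, hδ1⟩ := hδ
  have hN' : (0 : ℝ) < N := by exact_mod_cast hN
  rw [sqrt_div' _ (by positivity), sqrt_sq hN'.le, tvParameter]
  -- For N = 1 both sides vanish since log n = 0. Otherwise log(n/δ) ≥ 1 absorbs the 1 in log(en/δ),
  -- costing √2 ≤ 3/2 and turning 40 into 60.
  rcases (show N = 1 ∨ 2 ≤ N by omega) with rfl | hN2
  · simp
  have hN2' : (2 : ℝ) ≤ N := by exact_mod_cast hN2
  have hlog4 : 1 ≤ log ((N : ℝ) ^ 2) := by
    have := log_le_log two_pos hN2'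
    have := log_two_gt_d9
    rw [log_pow]; push_cast; linarith
  have h1 : log (exp 1 * (N : ℝ) ^ 2 / δ) = 1 + log ((N : ℝ) ^ 2 / δ) := by
    rw [mul_div_assoc, log_mul (by positivity) (by positivity), log_exp]
  have h2 : 1 ≤ log ((N : ℝ) ^ 2 / δ) := by
    refine hlog4.trans (log_le_log (by positivity) ?_)
    rw [le_div_iff₀ hδ0]; nlinarith [sq_nonneg (N : ℝ)]
  have h3 : 4 * √(log ((N : ℝ) ^ 2) * log (exp 1 * (N : ℝ) ^ 2 / δ)) ≤
      6 * √(log ((N : ℝ) ^ 2) * log ((N : ℝ) ^ 2 / δ)) := by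
    refine (pow_le_pow_iff_left₀ (by positivity) (by positivity) two_ne_zero).mp ?_
    rw [mul_pow, mul_pow, sq_sqrt, sq_sqrt, h1]
    · nlinarith
    · apply mul_nonneg <;> linarith
    · rw [h1]; apply mul_nonneg <;> linarith
  calc _ = 10 * σ / N * (4 * √(log ((N : ℝ) ^ 2) * log (exp 1 * (N : ℝ) ^ 2 / δ))) := by
        field_simp
    _ ≤ 10 * σ / N * (6 * √(log ((N : ℝ) ^ 2) * log ((N : ℝ) ^ 2 / δ))) := by gcongr
    _ = _ := by ring

lemma mse_le_of_noise_event {N : ℕ} (hN : 0 < N) {σ δ : ℝ} (hσ : 0 ≤ σ)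
    (hδ : δ ∈ Set.Ioo (0 : ℝ) 1) {θstar ε θup θhat : Image N} (hup : θup ∈ biIsotonic N)
    (hnoise : ∀ e : GridEdge N, |inner ℝ (pinvColumn e) ε| ≤
      (N : ℝ) ^ 2 * tvParameter 10 σ δ ((N : ℝ) ^ 2) / 2)
    (hmean : |inner ℝ (dctBasis N (⟨0, hN⟩, ⟨0, hN⟩)) ε| ≤ σ * √(2 * log (2 / δ)))
    (h : IsTVDenoiser (θstar + ε) (tvParameter 10 σ δ ((N : ℝ) ^ 2)) θhat) :
    mse θhat θstar ≤ mse θup θstar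
      + 60 * σ * √(log ((N : ℝ) ^ 2) * log ((N : ℝ) ^ 2 / δ) / (N : ℝ) ^ 2)
        * √(squareVariation hN θup)
      + 60 * (σ ^ 2 / (N : ℝ) ^ 2) * log (exp 1 / δ) := by
  have hN' : (0 : ℝ) < N := by exact_mod_cast hN
  have hδ0 := hδ.1
  set lam := tvParameter 10 σ δ ((N : ℝ) ^ 2) with hlam
  have hlam0 : 0 ≤ lam := by rw [hlam, tvParameter]; positivity
  have h1 := h.sq_dist_le hN hlam0 hnoise θup
  have h2 : inner ℝ (dctBasis N (⟨0, hN⟩, ⟨0, hN⟩)) ε ^ 2 ≤ 60 * σ ^ 2 * log (exp 1 / δ) := by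
    have hl0 : 0 ≤ log (2 / δ) := log_nonneg (by rw [le_div_iff₀ hδ0]; linarith [hδ.2])
    have hl : log (2 / δ) ≤ log (exp 1 / δ) := by
      apply log_le_log (by positivity)
      gcongr
      have := exp_one_gt_d9; linarith
    have := pow_le_pow_left₀ (abs_nonneg _) hmean 2
    rw [sq_abs, mul_pow, sq_sqrt (by positivity)] at this
    nlinarith [sq_nonneg σ, mul_le_mul_of_nonneg_left hl (sq_nonneg σ),
      mul_nonneg (sq_nonneg σ) (hl0.trans hl)]
  have h3 := mul_le_mul_of_nonneg_left (totalVariation_le_of_mem_biIsotonic hN hup)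
    (show 0 ≤ 2 * lam by positivity)
  have h4 := mul_le_mul_of_nonneg_right (tvParameter_mul_le hN hσ hδ)
    (sqrt_nonneg (squareVariation hN θup))
  rw [← hlam] at h4
  unfold mse
  calc 1 / (N : ℝ) ^ 2 * ‖θhat - θstar‖ ^ 2
      ≤ 1 / (N : ℝ) ^ 2 * (‖θup - θstar‖ ^ 2 + 60 * σ ^ 2 * log (exp 1 / δ) +
        2 * ((N : ℝ) ^ 2 * lam) * totalVariation θup) := by
        gcongr; linarith
    _ = 1 / (N : ℝ) ^ 2 * ‖θup - θstar‖ ^ 2 + 60 * (σ ^ 2 / (N : ℝ) ^ 2) * log (exp 1 / δ) +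
        2 * lam * totalVariation θup := by field_simp
    _ ≤ _ := by linarith

end TVDenoising

theorem mainTheorem9 :
    ∃ c : ℝ, 0 < c ∧ ∃ C : ℝ, 0 < C ∧
      ∀ (N : ℕ) (hN : 0 < N) (σ : ℝ) (_ : 0 ≤ σ) (δ : ℝ) (_ : δ ∈ Set.Ioo (0 : ℝ) 1)
        (n : ℝ) (_ : n = (N : ℝ) ^ 2)
        (θstar θup : TVDenoising.Image N)
        (_ : TVDenoising.IsProjectionOnto (TVDenoising.biIsotonic N) θstar θup)
        (Ω : Type*) [MeasurableSpace Ω] (P : Measure Ω) [IsProbabilityMeasure P]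
        (ε : Ω → TVDenoising.Image N)
        (_ : HasLaw ε (multivariateGaussian 0
          (σ ^ 2 • (1 : Matrix (Fin N × Fin N) (Fin N × Fin N) ℝ))) P),
        1 - 2 * δ ≤ P.real {ω | ∀ θhat : TVDenoising.Image N,
          TVDenoising.IsTVDenoiser (θstar + ε ω) (TVDenoising.tvParameter c σ δ n) θhat →
            TVDenoising.mse θhat θstar ≤
              TVDenoising.mse θup θstar
              + C * σ * √(Real.log n * Real.log (n / δ) / n)
                * √(TVDenoising.squareVariation hN θup)
              + C * (σ ^ 2 / n) * Real.log (Real.exp 1 / δ)} := by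
  refine ⟨10, by norm_num, 60, by norm_num, ?_⟩
  intro N hN σ hσ δ hδ n hn θstar θup hup Ω _ P _ ε hε
  subst hn
  have hbad := TVDenoising.measureReal_noise_event hN hσ hδ hε
  set G := {ω | ∀ e : TVDenoising.GridEdge N, |inner ℝ (TVDenoising.pinvColumn e) (ε ω)| ≤
        (N : ℝ) ^ 2 * TVDenoising.tvParameter 10 σ δ ((N : ℝ) ^ 2) / 2} ∩
      {ω | |inner ℝ (TVDenoising.dctBasis N (⟨0, hN⟩, ⟨0, hN⟩)) (ε ω)| ≤
        σ * √(2 * Real.log (2 / δ))} with hG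
  -- Subadditivity is enough here, so measurability of the event is never needed.
  have hcover : 1 ≤ P.real G + P.real Gᶜ := by
    have h := measureReal_union_le (μ := P) G Gᶜ
    rwa [Set.union_compl_self, probReal_univ] at h
  refine le_trans (by linarith) (measureReal_mono (μ := P) (s₁ := G) fun ω hω θhat hθ => ?_)
  exact TVDenoising.mse_le_of_noise_event hN hσ hδ hup.1 hω.1 hω.2 hθ
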